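/- Let $(K,v)$ be a henselian valued field, let $\overline K$ be an algebraic closure of $K$, and denote the unique extension of $v$ to $\overline K$ again by $v$ (written additively). Let $\deg_K(z)=[K(z):K]$ for $z\in\overline K$. Let $a\in\overline K\setminus K$ be such that $\mathcal E=(K(a)|K,v)$ is a finite Galois extension with nontrivial defect, that is, $$d(K(a)|K,v)=\frac{[K(a):K]}{(vK(a):vK)\,[K(a)v:Kv]}>1 .$$ For $1\le d<\deg_K(a)$ put $D_d=\{v(a-z)\mid z\in\overline K,\ \deg_K(z)=d\}$. An *Okutsu sequence* of $a$ over $K$ of length $n$ is a sequence $A_0=\{a\},A_1,\dots,A_n$ of nonempty subsets of $\overline K$ such that all elements of $A_i$ have the same degree $d_i$ over $K$ and 1. $\deg_K(a)=d_0>d_1>\dots>d_n=1$; 2. for $1\le i\le n$ and every $z\in\overline K$ with $\deg_K(z)<d_{i-1}$ there is $z_i\in A_i$ with $v(a-z_i)\ge v(a-z)$; 3. for $1\le i\le n$, $z_i\in A_i$ and $z_{i-1}\in A_{i-1}$ we have $v(a-z_{i-1})>v(a-z_i)$; 4. for $1\le i\le n$, $A_i$ is a singleton if and only if $\max D_{d_i}$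 exists, and if $A_i=\{a_i\}$, then $v(a-a_i)=\max D_{d_i}=\max\{v(a-z)\mid z\in\overline K,\ \deg_K(z)<d_{i-1}\}$; 5. for $1\le i\le n$, if $\max D_{d_i}$ does not exist, then $A_i=\{z_\nu\}_{\nu<\lambda}$ for a limit ordinal $\lambda$, with $v(a-z_\mu)>v(a-z_\nu)$ whenever $\nu<\mu<\lambda$. All Okutsu sequences of $a$ over $K$ have the same length, called the *depth* of $a$ over $K$. Assume that $a$ is *pure* over $K$, i.e. that its depth over $K$ is $1$. Assume further that $v(a-K)=\{v(a-z)\mid z\in K\}$ is a *principal* initial segment of $vK$, that is, $v(a-K)=\{\gamma'\in vK\mid \gamma'<\gamma\}$ for some $\gamma\in vK$. For a subgroup $H$ of $\mathrm{Gal}(K(a)|K)$ let $\mathcal I_H$ be the ideal of the valuation ring $\mathcal O_{K(a)}$ generated by the elements $\frac{\sigma z}{z}-1$ with $\sigma\in H$ and $z\in K(a)^\times$. A *ramification ideal* of $\mathcal E$ is a nonzero ideal of $\mathcal O_{K(a)}$ that is contained in the maximal ideal $\mathcal M_{K(a)}$ and equals $\mathcal I_H$ for some subgroup $H$; let $\mathrm{Ram}(\mathcal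 E)$ be the set of all ramification ideals. Let $$S_K(a)=\{v(a-a')\mid a'\ne a\text{ is a }K\text{-conjugate of }a\}.$$ Then $$\#\,\mathrm{Ram}(\mathcal E)=\#\,S_K(a).$$ -/

import Mathlib

/-!
Conventions. Valuations are Mathlib's multiplicative valuations `v : Valuation F Γ₀`, so the order
is reversed with respect to the additive notation used in valuation theory: additively
`v x < v y` is written `v y < v x` here, the value `∞` is `0`, `min` and `max` are exchanged, and
the valuation ring is `{x | v x ≤ 1}`.

Throughout, `Kbar` is an algebraic closure of the field `K`, and `v` is a valuation of `Kbar`. All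
subextensions of `Kbar | K`, and `K` itself, are valued by the restriction of `v`.
-/

namespace ValuedExtension

open IsLocalRing

section Defect

/-- The value group `vF` of a valued field `(F, v)`, as a subgroup of the units of `Γ₀`. -/
def valueGroup {F Γ₀ : Type*} [Field F] [LinearOrderedCommGroupWithZero Γ₀]
    (v : Valuation F Γ₀) : Subgroup Γ₀ˣ :=
  (Units.map (v : F →* Γ₀)).range

/-- The restriction to `K` of a valuation `w` of `L`. -/
abbrev restrict (K : Type*) {L Γ₀ : Type*} [Field K] [Field L] [Algebra K L]
    [LinearOrderedCommGroupWithZero Γ₀] (w : Valuation L Γ₀) : Valuation K Γ₀ :=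
  w.comap (algebraMap K L)

instance hasExtension_restrict (K : Type*) {L Γ₀ : Type*} [Field K] [Field L] [Algebra K L]
    [LinearOrderedCommGroupWithZero Γ₀] (w : Valuation L Γ₀) :
    (restrict K w).HasExtension w :=
  ⟨Valuation.IsEquiv.refl⟩

/-- The ramification index `(vL : vK)` of `(L|K, w)`. -/
noncomputable def ramificationIndex (K : Type*) {L Γ₀ : Type*} [Field K] [Field L] [Algebra K L]
    [LinearOrderedCommGroupWithZero Γ₀] (w : Valuation L Γ₀) : ℕ :=
  (valueGroup (restrict K w)).relIndex (valueGroup w)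

/-- The residue degree `[Lv : Kv]` of `(L|K, w)`. -/
noncomputable def residueDegree (K : Type*) {L Γ₀ : Type*} [Field K] [Field L] [Algebra K L]
    [LinearOrderedCommGroupWithZero Γ₀] (w : Valuation L Γ₀) : ℕ :=
  Module.finrank (ResidueField (restrict K w).valuationSubring)
    (ResidueField w.valuationSubring)

/-- The defect `d(L|K, w) = [L : K] / ((vL : vK) [Lv : Kv])` of a finite extension to which the
valuation of `K` extends uniquely. -/
noncomputable def defect (K : Type*) {L Γ₀ : Type*} [Field K] [Field L] [Algebra K L]
    [LinearOrderedCommGroupWithZero Γ₀] (w : Valuation L Γ₀) : ℚ :=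
  (Module.finrank K L : ℚ) / ((ramificationIndex K w : ℚ) * (residueDegree K w : ℚ))

end Defect

section Henselian

/-- The valued field `(K, v)` is henselian: `v` has exactly one extension to the algebraic closure
`Kbar` of `K`. Extensions are identified with their valuation rings, i.e. counted up to
equivalence of valuations. -/
def IsHenselian {K Γ₀ : Type*} (Kbar : Type*) [Field K] [Field Kbar] [Algebra K Kbar]
    [LinearOrderedCommGroupWithZero Γ₀] (v : Valuation K Γ₀) : Prop :=
  ∃! A : ValuationSubring Kbar, A.comap (algebraMap K Kbar) = v.valuationSubring

end Henselian

section Ramification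

/-- The ideal `I_H` of the valuation ring `O_L` of `(L, w)` generated by the elements `σ z / z - 1`
with `σ ∈ H` and `z ∈ Lˣ`. (If `K` is henselian then all of these elements do lie in `O_L`.) -/
def idealOfSubgroup {K L Γ₀ : Type*} [Field K] [Field L] [Algebra K L]
    [LinearOrderedCommGroupWithZero Γ₀] (w : Valuation L Γ₀) (H : Subgroup (L ≃ₐ[K] L)) :
    Ideal w.valuationSubring :=
  Ideal.span {x : w.valuationSubring | ∃ σ ∈ H, ∃ z : L, z ≠ 0 ∧ (x : L) = σ z / z - 1}

/-- The set `Ram(L|K, w)` of ramification ideals: the ideals of `O_L` that are nonzero, contained in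
the maximal ideal, and of the form `I_H` for a subgroup `H` of the Galois group. -/
def ramificationIdeals (K : Type*) {L Γ₀ : Type*} [Field K] [Field L] [Algebra K L]
    [LinearOrderedCommGroupWithZero Γ₀] (w : Valuation L Γ₀) :
    Set (Ideal w.valuationSubring) :=
  {I | I ≠ ⊥ ∧ I ≤ maximalIdeal w.valuationSubring ∧
    ∃ H : Subgroup (L ≃ₐ[K] L), I = idealOfSubgroup w H}

end Ramification

section Elements

/-- The degree of `z` over `K`. -/
noncomputable def deg (K : Type*) {Kbar : Type*} [Field K] [Field Kbar] [Algebra K Kbar]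
    (z : Kbar) : ℕ :=
  (minpoly K z).natDegree

/-- `S_K(a) = {v(a - a') | a' ≠ a is a K-conjugate of a}`. -/
def conjugateValues (K : Type*) {Kbar Γ₀ : Type*} [Field K] [Field Kbar] [Algebra K Kbar]
    [LinearOrderedCommGroupWithZero Γ₀] (v : Valuation Kbar Γ₀) (a : Kbar) : Set Γ₀ :=
  {γ | ∃ a' : Kbar, IsConjRoot K a a' ∧ a' ≠ a ∧ γ = v (a - a')}

/-- `v(a - K) = {v(a - z) | z ∈ K}`. -/
def distanceValues (K : Type*) {Kbar Γ₀ : Type*} [Field K] [Field Kbar] [Algebra K Kbar]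
    [LinearOrderedCommGroupWithZero Γ₀] (v : Valuation Kbar Γ₀) (a : Kbar) : Set Γ₀ :=
  {γ | ∃ z : K, γ = v (a - algebraMap K Kbar z)}

/-- `S` is a principal initial segment of the value group `G`: additively,
`S = {γ' ∈ G | γ' < γ}` for some `γ ∈ G`. -/
def IsPrincipalInitialSegment {Γ₀ : Type*} [LinearOrderedCommGroupWithZero Γ₀]
    (G : Subgroup Γ₀ˣ) (S : Set Γ₀) : Prop :=
  ∃ γ ∈ G, S = {x : Γ₀ | ∃ γ' ∈ G, γ < γ' ∧ x = (γ' : Γ₀)}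

/-- `D_d(a, K) = {v(a - z) | z ∈ Kbar of degree d over K}`. -/
def degreeValues (K : Type*) {Kbar Γ₀ : Type*} [Field K] [Field Kbar] [Algebra K Kbar]
    [LinearOrderedCommGroupWithZero Γ₀] (v : Valuation Kbar Γ₀) (a : Kbar) (d : ℕ) : Set Γ₀ :=
  {γ | ∃ z : Kbar, deg K z = d ∧ γ = v (a - z)}

universe u

/-- `A 0, A 1, …, A n` (the values of `A` and `d` beyond `n` play no role) is an Okutsu sequence of
length `n` of `a` over `K`, with common degrees `d 0, …, d n`.
An additive maximum of a set of values is an `IsLeast` element here. -/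
structure IsOkutsuSequence (K : Type*) {Kbar : Type u} {Γ₀ : Type*} [Field K] [Field Kbar]
    [Algebra K Kbar] [LinearOrderedCommGroupWithZero Γ₀] (v : Valuation Kbar Γ₀) (a : Kbar)
    (n : ℕ) (A : ℕ → Set Kbar) (d : ℕ → ℕ) : Prop where
  /-- The sequence starts with `{a}`. -/
  start : A 0 = {a}
  /-- Each `A i` is a nonempty set of elements of common degree `d i`. -/
  nonempty : ∀ i ≤ n, (A i).Nonempty
  common_degree : ∀ i ≤ n, ∀ z ∈ A i, deg K z = d i
  /-- `deg a = d 0 > d 1 > … > d n = 1`. -/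
  degree_lt : ∀ i < n, d (i + 1) < d i
  degree_last : d n = 1
  /-- Every `z` of degree less than `d i` is at most as close to `a` as some element of
  `A (i + 1)`. -/
  cofinal : ∀ i < n, ∀ z : Kbar, deg K z < d i → ∃ z' ∈ A (i + 1), v (a - z') ≤ v (a - z)
  /-- The elements of `A i` are strictly closer to `a` than those of `A (i + 1)`. -/
  closer : ∀ i < n, ∀ x ∈ A i, ∀ y ∈ A (i + 1), v (a - x) < v (a - y)
  /-- `A (i + 1)` is a singleton if and only if the set of values for degree `d (i + 1)` has an
  (additive) maximum. -/
  singleton_iff : ∀ i < n,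
    (∃ x, A (i + 1) = {x}) ↔ ∃ γ, IsLeast (degreeValues K v a (d (i + 1))) γ
  /-- If `A (i + 1) = {x}` then `v (a - x)` is this maximum, and it is also the (additive) maximum
  of the values `v (a - z)` for all `z` of degree less than `d i`. -/
  singleton_max : ∀ i < n, ∀ x, A (i + 1) = {x} →
    IsLeast (degreeValues K v a (d (i + 1))) (v (a - x)) ∧
    IsLeast {γ | ∃ z : Kbar, deg K z < d i ∧ γ = v (a - z)} (v (a - x))
  /-- If there is no maximum, then `A (i + 1)` is a sequence indexed by the ordinals below a limit
  ordinal along which the distances to `a` strictly improve. -/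
  limit : ∀ i < n, (¬ ∃ γ, IsLeast (degreeValues K v a (d (i + 1))) γ) →
    ∃ o : Ordinal.{u}, Order.IsSuccLimit o ∧ ∃ z : Ordinal.{u} → Kbar,
      A (i + 1) = z '' Set.Iio o ∧ StrictAntiOn (fun ν => v (a - z ν)) (Set.Iio o)

/-- The depth of `a` over `K`: the length of an Okutsu sequence of `a` over `K`. (All of them have
the same length; formally, the least length is taken.) -/
noncomputable def depth (K : Type*) {Kbar Γ₀ : Type*} [Field K] [Field Kbar]
    [Algebra K Kbar] [LinearOrderedCommGroupWithZero Γ₀] (v : Valuation Kbar Γ₀) (a : Kbar) : ℕ :=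
  sInf {n | ∃ (A : ℕ → Set Kbar) (d : ℕ → ℕ), IsOkutsuSequence K v a n A d}

/-- `a` is pure over `K` if it has depth one. -/
def IsPure (K : Type*) {Kbar Γ₀ : Type*} [Field K] [Field Kbar]
    [Algebra K Kbar] [LinearOrderedCommGroupWithZero Γ₀] (v : Valuation Kbar Γ₀) (a : Kbar) :
    Prop :=
  depth K v a = 1

end Elements

end ValuedExtension

/-! The values below are multiplicative, so closer means smaller; let `γ` bound `v(a - K)` strictly
from below. By purity, some element of `K` is at least as close to `a` as any given element of
degree below `n = deg K a`. If a closest `c` in `K` existed, `a - c` scaled to value `1` would have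
powers with residues independent up to exponent `n - 1`; the residue degree would be at least `n`,
contradicting the defect (`exists_strictly_closer`). So some `c` in `K` is closer to `a` than all
roots of a given `f` of degree below `n`, whence `v (f a) = v (f c)`: the value group does not grow
(`exists_valuation_aeval_eq`).

Consequently `v (σ a - a) ≤ γ`, while every root `r` of such an `f` has `v (a - r) > γ`. Factoring
`z = f a` makes `σ z / z` a product of terms `1 + (σ a - a) / (a - r)`, so `v (σ z / z - 1) * γ < v
(σ a - a)` for `σ ≠ 1`. The elements `z = a - c` realise all values allowed by this bound. Thus
`I_H` depends only on the largest `s = v (σ a - a)` with `σ` in `H`: it is the ideal `v x * γ < s`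
(`ramificationIdeals_eq_image`). Since `γ` is itself a value, different `s` give different ideals
(`ltIdeal_injOn`). -/

namespace ValuedExtension

open IsLocalRing Polynomial

/-! ### Purity, residue degree and defect -/

/-- Elements of smaller degree than a pure element are at most as close to it as some element of
the base field. -/
theorem IsPure.exists_closer {K Kbar Γ₀ : Type*} [Field K] [Field Kbar] [Algebra K Kbar]
    [LinearOrderedCommGroupWithZero Γ₀] {v : Valuation Kbar Γ₀} {a : Kbar} (h : IsPure K v a) :
    ∀ z : Kbar, deg K z < deg K a →
      ∃ c : K, v (a - algebraMap K Kbar c) ≤ v (a - z) := by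
  -- The infimum of the empty set is `0`, so depth `1` guarantees that an Okutsu sequence exists.
  have hne : {n | ∃ (A : ℕ → Set Kbar) (d : ℕ → ℕ), IsOkutsuSequence K v a n A d}.Nonempty := by
    by_contra hempty
    rw [Set.not_nonempty_iff_eq_empty] at hempty
    rw [IsPure, depth, hempty, Nat.sInf_empty] at h
    omega
  obtain ⟨A, d, hA⟩ : ∃ (A : ℕ → Set Kbar) (d : ℕ → ℕ), IsOkutsuSequence K v a 1 A d := by
    have := Nat.sInf_mem hne
    rwa [show sInf _ = 1 from h] at this
  have h0 : deg K a = d 0 := hA.common_degree 0 (by omega) a (by simp [hA.start])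
  intro z hz
  obtain ⟨z', hz', hle⟩ := hA.cofinal 0 (by omega) z (by omega)
  have h1 := hA.common_degree 1 le_rfl z' hz'
  rw [hA.degree_last, deg, minpoly.natDegree_eq_one_iff] at h1
  obtain ⟨c, rfl⟩ := h1
  exact ⟨c, hle⟩

/-- The coefficients of `∏ (X - r)` are bounded by the value of this polynomial at an integral
element `a` whose residue is no residue of any of the `r`. -/
theorem valuation_coeff_prod_X_sub_C_le {F Γ₀ : Type*} [Field F]
    [LinearOrderedCommGroupWithZero Γ₀] (v : Valuation F Γ₀) {a : F} (ha : v a ≤ 1)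
    (R : Multiset F) (hR : ∀ r ∈ R, 1 ≤ v (a - r)) (k : ℕ) :
    v ((R.map fun r => X - C r).prod.coeff k) ≤ v (R.map fun r => a - r).prod := by
  induction R using Multiset.induction_on generalizing k with
  | empty =>
    simp only [Multiset.map_zero, Multiset.prod_zero, map_one, coeff_one]
    split_ifs <;> simp
  | cons r R ih =>
    have hr : 1 ≤ v (a - r) := hR r (by simp)
    have ih' := ih (fun r' h' => hR r' (by simp [h']))
    have hvr : v r ≤ v (a - r) := by
      have := v.map_sub a (a - r)
      rw [sub_sub_cancel] at this
      exact this.trans (max_le (ha.trans hr) le_rfl)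
    -- A new coefficient is an old one minus `r` times the next; the factors `1` and `v r` are both
    -- at most `v (a - r)`.
    simp only [Multiset.map_cons, Multiset.prod_cons, sub_mul, coeff_sub, coeff_C_mul]
    refine (v.map_sub _ _).trans (max_le ?_ ?_)
    · rw [← sub_mul, map_mul]
      cases k with
      | zero => simp
      | succ k =>
        rw [coeff_X_mul]
        calc _ = 1 * v ((R.map fun r => X - C r).prod.coeff k) := (one_mul _).symm
          _ ≤ _ := mul_le_mul' hr (ih' k)
    · rw [← sub_mul, map_mul, map_mul]
      exact mul_le_mul' hvr (ih' k)

/-- If `b` is integral and its powers below the `n`-th have residues which are linearly independent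
over the residue field of `K`, then the residue degree, if finite, is at least `n`. -/
theorem residueDegree_eq_zero_or_le {K L Γ₀ : Type*} [Field K] [Field L] [Algebra K L]
    [LinearOrderedCommGroupWithZero Γ₀] (w : Valuation L Γ₀) {b : L} (hb : w b ≤ 1) (n : ℕ)
    (h : ∀ d : Fin n → K, (∀ i, restrict K w (d i) ≤ 1) →
      w (∑ i, algebraMap K L (d i) * b ^ (i : ℕ)) < 1 → ∀ i, restrict K w (d i) < 1) :
    residueDegree K w = 0 ∨ n ≤ residueDegree K w := by
  by_cases hfin : Module.Finite (ResidueField (restrict K w).valuationSubring)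
    (ResidueField w.valuationSubring)
  swap
  · exact Or.inl (Module.finrank_of_not_finite hfin)
  right
  let β : w.valuationSubring := ⟨b, hb⟩
  have hli : LinearIndependent (ResidueField (restrict K w).valuationSubring)
      (fun i : Fin n => (residue w.valuationSubring β) ^ (i : ℕ)) := by
    rw [Fintype.linearIndependent_iff]
    intro c hc
    choose d hd using fun i => residue_surjective (c i)
    have hsum : residue w.valuationSubring
        (∑ i, algebraMap (restrict K w).valuationSubring w.valuationSubring (d i) * β ^ (i : ℕ))
          = 0 := by
      rw [← hc, map_sum]
      refine Finset.sum_congr rfl fun i _ => ?_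
      rw [map_mul, map_pow, ← hd, Algebra.smul_def]
      rfl
    rw [residue_eq_zero_iff, Valuation.mem_maximalIdeal_iff] at hsum
    have := h (fun i => d i) (fun i => (d i).2) (by
      convert hsum using 2
      push_cast
      rfl)
    intro i
    rw [← hd, residue_eq_zero_iff, Valuation.mem_maximalIdeal_iff]
    exact this i
  simpa [residueDegree] using hli.fintype_card_le_finrank

/-- An extension whose residue degree is zero or at least the degree has no defect. -/
theorem defect_le_one {K L Γ₀ : Type*} [Field K] [Field L] [Algebra K L]
    [LinearOrderedCommGroupWithZero Γ₀] (w : Valuation L Γ₀)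
    (h : residueDegree K w = 0 ∨ Module.finrank K L ≤ residueDegree K w) : defect K w ≤ 1 := by
  unfold defect
  -- An infinite index or residue degree is recorded as `0`, and then the quotient is `0` too.
  rcases Nat.eq_zero_or_pos (ramificationIndex K w) with he | he
  · simp [he]
  rcases h with hf | hf
  · simp [hf]
  · apply div_le_one_of_le₀ _ (by positivity)
    exact_mod_cast hf.trans (Nat.le_mul_of_pos_left _ he)

/-! ### Galois invariance of the valuation -/

/-- The valuation of a henselian field is preserved by the automorphisms of an algebraic
closure. -/
theorem IsHenselian.valuation_algEquiv {K Kbar Γ₀ : Type*} [Field K] [Field Kbar] [Algebra K Kbar]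
    [LinearOrderedCommGroupWithZero Γ₀] [Algebra.IsAlgebraic K Kbar] {v : Valuation Kbar Γ₀}
    (h : IsHenselian Kbar (restrict K v)) (τ : Kbar ≃ₐ[K] Kbar) (x : Kbar) : v (τ x) = v x := by
  have key : ∀ τ : Kbar ≃ₐ[K] Kbar, ∀ x, v (τ x) ≤ v x := by
    intro τ x
    have heq : v.valuationSubring = (v.comap (τ : Kbar →+* Kbar)).valuationSubring := by
      apply h.unique
      · ext y; rfl
      · ext y
        simp [ValuationSubring.mem_comap, Valuation.mem_valuationSubring_iff]
    have hequiv := (Valuation.isEquiv_iff_valuationSubring _ _).2 heq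
    by_contra! hlt
    -- Uniqueness of the valuation ring only gives equivalence of `v` and `v ∘ τ`. Equivalence
    -- propagates a strict increase along the whole orbit of `x`, which is finite.
    have hstep : ∀ k : ℕ, v ((τ ^ k) x) < v ((τ ^ (k + 1)) x) := by
      intro k
      induction k with
      | zero => simpa using hlt
      | succ k ih =>
        have h1 : (τ ^ (k + 1)) x = τ ((τ ^ k) x) := by rw [pow_succ', AlgEquiv.mul_apply]
        have h2 : (τ ^ (k + 1 + 1)) x = τ ((τ ^ (k + 1)) x) := by
          rw [pow_succ' τ (k + 1), AlgEquiv.mul_apply]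
        rw [h2]
        nth_rw 1 [h1]
        exact hequiv.lt_iff_lt.1 ih
    have hmono : StrictMono fun k : ℕ => v ((τ ^ k) x) := strictMono_nat_of_lt_succ hstep
    have hroots : ∀ k : ℕ, (τ ^ k) x ∈ (minpoly K x).rootSet Kbar := by
      intro k
      rw [mem_rootSet]
      refine ⟨minpoly.ne_zero (Algebra.IsIntegral.isIntegral x), ?_⟩
      rw [aeval_algHom_apply (τ ^ k) x, minpoly.aeval, map_zero]
    have hinj : Function.Injective fun k : ℕ =>
        (⟨(τ ^ k) x, hroots k⟩ : (minpoly K x).rootSet Kbar) := by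
      intro i j hij
      exact hmono.injective (congrArg v (Subtype.ext_iff.1 hij))
    exact not_injective_infinite_finite _ hinj
  refine le_antisymm (key τ x) ?_
  simpa using key τ.symm (τ x)

/-! ### Ideals cut out by a strict bound, and products of 1-units -/

/-- The ideal of the elements `x` of a valuation ring with `v x * γ < s` (or `x = 0`). -/
def ltIdeal {L Γ₀ : Type*} [Field L] [LinearOrderedCommGroupWithZero Γ₀] (w : Valuation L Γ₀)
    (γ s : Γ₀) : Ideal w.valuationSubring where
  carrier := {x | x ≠ 0 → w x * γ < s}
  zero_mem' := fun h => (h rfl).elim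
  add_mem' := by
    intro x y hx hy hxy
    rcases eq_or_ne x 0 with rfl | hx0
    · simpa using hy (by simpa using hxy)
    rcases eq_or_ne y 0 with rfl | hy0
    · simpa using hx hx0
    rcases le_max_iff.1 (w.map_add (x : L) y) with h | h
    · exact (mul_le_mul_left h γ).trans_lt (hx hx0)
    · exact (mul_le_mul_left h γ).trans_lt (hy hy0)
  smul_mem' := by
    intro c x hx hcx
    refine lt_of_le_of_lt ?_ (hx (right_ne_zero_of_mul hcx))
    refine mul_le_mul_left ?_ γ
    have hc : w c ≤ 1 := c.2
    simpa using mul_le_mul_left hc (w x)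

theorem mem_ltIdeal {L Γ₀ : Type*} [Field L] [LinearOrderedCommGroupWithZero Γ₀]
    {w : Valuation L Γ₀} {γ s : Γ₀} {x : w.valuationSubring} :
    x ∈ ltIdeal w γ s ↔ (x ≠ 0 → w x * γ < s) := Iff.rfl

theorem mem_ltIdeal_of_pos {L Γ₀ : Type*} [Field L] [LinearOrderedCommGroupWithZero Γ₀]
    {w : Valuation L Γ₀} {γ s : Γ₀} (hs : 0 < s) {x : w.valuationSubring} :
    x ∈ ltIdeal w γ s ↔ w x * γ < s := by
  rw [mem_ltIdeal]
  refine ⟨fun h => ?_, fun h _ => h⟩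
  rcases eq_or_ne x 0 with rfl | hx
  · simpa using hs
  · exact h hx

/-- If each factor `a - r` has value above `γ`, then replacing `a` by an element `b` close to `a`
changes a product of such factors only by a `1`-unit. -/
theorem valuation_prod_div_prod_sub_one {F Γ₀ : Type*} [Field F]
    [LinearOrderedCommGroupWithZero Γ₀] (v : Valuation F Γ₀) {a b : F} {γ : Γ₀} (hγ : 0 < γ)
    (hab : a ≠ b) (hle : v (b - a) ≤ γ) (R : Multiset F) (hR : ∀ r ∈ R, γ < v (a - r)) :
    v ((R.map fun r => b - r).prod / (R.map fun r => a - r).prod - 1) * γ < v (b - a) := by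
  have hpos : 0 < v (b - a) := by
    rw [zero_lt_iff, v.ne_zero_iff, sub_ne_zero]
    exact hab.symm
  induction R using Multiset.induction_on with
  | empty => simpa using hpos
  | cons r R ih =>
    have hr : γ < v (a - r) := hR r (by simp)
    have hr0 : a - r ≠ 0 := by
      rw [← v.ne_zero_iff]; exact (hγ.trans hr).ne'
    -- One factor differs from `1` by `(b - a) / (a - r)`, whose denominator has value above `γ`.
    have h1 : v ((b - r) / (a - r) - 1) * γ < v (b - a) := by
      rw [show (b - r) / (a - r) - 1 = (b - a) / (a - r) by field_simp; ring, map_div₀,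
        div_mul_eq_mul_div, div_lt_iff₀ (hγ.trans hr)]
      exact (mul_lt_mul_iff_right₀ hpos).2 hr
    have h2 := ih fun r' h' => hR r' (by simp [h'])
    have h3 : v ((b - r) / (a - r)) ≤ 1 := by
      rw [map_div₀, div_le_one₀ (hγ.trans hr)]
      have := v.map_add (b - a) (a - r)
      rw [sub_add_sub_cancel] at this
      exact this.trans (max_le (hle.trans hr.le) le_rfl)
    simp only [Multiset.map_cons, Multiset.prod_cons]
    set P := (R.map fun r => b - r).prod / (R.map fun r => a - r).prod with hP
    rw [mul_div_mul_comm, ← hP,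
      show (b - r) / (a - r) * P - 1 = (b - r) / (a - r) * (P - 1) + ((b - r) / (a - r) - 1) by
        ring]
    rcases le_max_iff.1 (v.map_add ((b - r) / (a - r) * (P - 1)) ((b - r) / (a - r) - 1))
      with h | h
    · refine ((mul_le_mul_left h γ).trans (mul_le_mul_left ?_ γ)).trans_lt h2
      rw [map_mul]
      simpa using mul_le_mul_left h3 (v (P - 1))
    · exact (mul_le_mul_left h γ).trans_lt h1

/-! ### Degrees and factorisation over the algebraic closure -/

theorem deg_le_natDegree {K Kbar : Type*} [Field K] [Field Kbar] [Algebra K Kbar] {z : Kbar}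
    {p : K[X]} (hp : p ≠ 0) (hz : aeval z p = 0) : deg K z ≤ p.natDegree :=
  natDegree_le_of_dvd (minpoly.dvd K z hz) hp

/-- Composing the minimal polynomial of `r` with the inverse affine map keeps its degree. This
transports degree bounds back through the normalisation `b = (a - c) / B`. -/
theorem deg_algebraMap_add_mul_le {K Kbar : Type*} [Field K] [Field Kbar] [Algebra K Kbar]
    {r : Kbar} (hr : IsIntegral K r) (c : K) {B : K} (hB : B ≠ 0) :
    deg K (algebraMap K Kbar c + algebraMap K Kbar B * r) ≤ deg K r := by
  have hB' : algebraMap K Kbar B ≠ 0 := by simpa using hB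
  have hdeg : ((minpoly K r).comp (C B⁻¹ * (X - C c))).natDegree = deg K r := by
    rw [natDegree_comp, natDegree_C_mul (inv_ne_zero hB), natDegree_X_sub_C, mul_one, deg]
  rw [← hdeg]
  refine deg_le_natDegree ?_ ?_
  · intro h
    rw [h, natDegree_zero] at hdeg
    exact (minpoly.natDegree_pos hr).ne hdeg
  · rw [aeval_comp]
    have : aeval (algebraMap K Kbar c + algebraMap K Kbar B * r) (C B⁻¹ * (X - C c)) = r := by
      simp [hB']
    rw [this, minpoly.aeval]

theorem deg_lt_of_mem_aroots {K Kbar : Type*} [Field K] [Field Kbar] [Algebra K Kbar] {f : K[X]}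
    {n : ℕ} (hn : f.natDegree < n) {r : Kbar} (hr : r ∈ f.aroots Kbar) : deg K r < n := by
  rw [mem_aroots] at hr
  exact (deg_le_natDegree hr.1 hr.2).trans_lt hn

theorem aeval_eq_mul_prod {K Kbar : Type*} [Field K] [Field Kbar] [Algebra K Kbar]
    [IsAlgClosed Kbar] (f : K[X]) (x : Kbar) :
    aeval x f = algebraMap K Kbar f.leadingCoeff * ((f.aroots Kbar).map fun r => x - r).prod := by
  rw [aeval_def, ← eval_map, (IsAlgClosed.splits _).eval_eq_prod_roots, leadingCoeff_map]

theorem coeff_eq_mul_coeff_prod {K Kbar : Type*} [Field K] [Field Kbar] [Algebra K Kbar]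
    [IsAlgClosed Kbar] (f : K[X]) (k : ℕ) :
    algebraMap K Kbar (f.coeff k) = algebraMap K Kbar f.leadingCoeff *
      ((f.aroots Kbar).map fun r => X - C r).prod.coeff k := by
  rw [← coeff_map, ← coeff_C_mul, ← leadingCoeff_map]
  exact congrArg (coeff · k) (IsAlgClosed.splits (f.map (algebraMap K Kbar))).eq_prod_roots

/-! ### Consequences of defect and purity for values at `a` -/

open scoped IntermediateField in
/-- If `a` generates a defect extension and some element of `K` is as close to `a` as any element
of smaller degree, then `v(a - K)` has no maximum in the value group of `K`. -/
theorem exists_strictly_closer {K Kbar Γ₀ : Type*} [Field K] [Field Kbar] [Algebra K Kbar]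
    [IsAlgClosed Kbar] [Algebra.IsAlgebraic K Kbar] [LinearOrderedCommGroupWithZero Γ₀]
    {v : Valuation Kbar Γ₀} {a : Kbar} (hdefect : 1 < defect K (restrict K⟮a⟯ v))
    (hcl : ∀ z : Kbar, deg K z < deg K a → ∃ c : K, v (a - algebraMap K Kbar c) ≤ v (a - z))
    (hval : ∀ c : K, ∃ B : K, B ≠ 0 ∧ v (a - algebraMap K Kbar c) = v (algebraMap K Kbar B))
    (c : K) : ∃ c' : K, v (a - algebraMap K Kbar c') < v (a - algebraMap K Kbar c) := by
  by_contra! hmin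
  obtain ⟨B, hB, hvB⟩ := hval c
  have hB' : algebraMap K Kbar B ≠ 0 := by simpa using hB
  have hvB0 : 0 < v (algebraMap K Kbar B) := by rwa [zero_lt_iff, v.ne_zero_iff]
  refine hdefect.not_ge (defect_le_one _ ?_)
  have ha : IsIntegral K a := Algebra.IsIntegral.isIntegral a
  let b : K⟮a⟯ := (IntermediateField.AdjoinSimple.gen K a - algebraMap K K⟮a⟯ c) /
    algebraMap K K⟮a⟯ B
  have hbcoe : (b : Kbar) = (a - algebraMap K Kbar c) / algebraMap K Kbar B := rfl
  have hvb : v (b : Kbar) = 1 := by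
    rw [hbcoe, map_div₀, hvB, div_self hvB0.ne']
  rw [IntermediateField.adjoin.finrank ha]
  refine residueDegree_eq_zero_or_le _ (b := b) hvb.le _ fun d _ hd i => ?_
  -- The linear combination of powers of `b` becomes `g b`. Roots of `g` have degree below that of
  -- `a`, so none is closer to `b` than `1`, and `v (g b)` dominates every coefficient of `g`.
  let g : K[X] := ∑ i : Fin (minpoly K a).natDegree, C (d i) * X ^ (i : ℕ)
  have hcoeff : g.coeff i = d i := by
    simp only [g, finsetSum_coeff, coeff_C_mul, coeff_X_pow]
    rw [Finset.sum_eq_single i]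
    · simp
    · intro j _ hj
      rw [if_neg (fun h => hj (Fin.ext h.symm)), mul_zero]
    · simp
  have hdeg : g.natDegree < (minpoly K a).natDegree := by
    rcases eq_or_ne g 0 with h | h
    · rw [h, natDegree_zero]
      exact minpoly.natDegree_pos ha
    · exact (natDegree_lt_iff_degree_lt h).2 (degree_sum_fin_lt d)
  have hg : v (aeval (b : Kbar) g) < 1 := by
    convert hd using 1
    simp only [g, map_sum, map_mul, aeval_C, map_pow, aeval_X, Valuation.comap_apply]
    congr 1
  refine lt_of_le_of_lt ?_ hg
  change v (algebraMap K Kbar (d i)) ≤ _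
  rw [← hcoeff, coeff_eq_mul_coeff_prod, aeval_eq_mul_prod, map_mul, map_mul]
  refine mul_le_mul' le_rfl (valuation_coeff_prod_X_sub_C_le v hvb.le _ (fun r hr => ?_) _)
  obtain ⟨c', hc'⟩ := hcl _
    ((deg_algebraMap_add_mul_le (Algebra.IsIntegral.isIntegral r) c hB).trans_lt
      (deg_lt_of_mem_aroots hdeg hr))
  have hle := (hmin c').trans hc'
  rw [hvB] at hle
  have : (b : Kbar) - r =
      (a - (algebraMap K Kbar c + algebraMap K Kbar B * r)) / algebraMap K Kbar B := by
    rw [hbcoe]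
    field_simp
    ring
  rwa [this, map_div₀, one_le_div₀ hvB0]

/-- The values of polynomials of small degree at `a` lie in the value group of `K`. -/
theorem exists_valuation_aeval_eq {K Kbar Γ₀ : Type*} [Field K] [Field Kbar] [Algebra K Kbar]
    [IsAlgClosed Kbar] [LinearOrderedCommGroupWithZero Γ₀] {v : Valuation Kbar Γ₀} {a : Kbar}
    (hcl : ∀ z : Kbar, deg K z < deg K a → ∃ c : K, v (a - algebraMap K Kbar c) ≤ v (a - z))
    (hno : ∀ c : K, ∃ c' : K, v (a - algebraMap K Kbar c') < v (a - algebraMap K Kbar c))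
    {f : K[X]} (hf : f.natDegree < deg K a) :
    ∃ k : K, v (algebraMap K Kbar k) = v (aeval a f) := by
  -- As there is no closest element of `K`, a single `c` can be strictly closer to `a` than finitely
  -- many elements of smaller degree.
  have hc : ∀ R : Multiset Kbar, (∀ r ∈ R, deg K r < deg K a) →
      ∃ c : K, ∀ r ∈ R, v (a - algebraMap K Kbar c) < v (a - r) := by
    intro R
    induction R using Multiset.induction_on with
    | empty => exact fun _ => ⟨0, by simp⟩
    | cons r R ih =>
      intro hR
      obtain ⟨c₁, h₁⟩ := ih fun r' h' => hR r' (by simp [h'])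
      obtain ⟨c₂, h₂⟩ := hcl r (hR r (by simp))
      obtain ⟨c₃, h₃⟩ := hno c₂
      rcases le_total (v (a - algebraMap K Kbar c₁)) (v (a - algebraMap K Kbar c₃)) with h | h
      · refine ⟨c₁, fun r' h' => ?_⟩
        rcases Multiset.mem_cons.1 h' with rfl | h'
        · exact h.trans_lt (h₃.trans_le h₂)
        · exact h₁ r' h'
      · refine ⟨c₃, fun r' h' => ?_⟩
        rcases Multiset.mem_cons.1 h' with rfl | h'
        · exact h₃.trans_le h₂
        · exact h.trans_lt (h₁ r' h')
  obtain ⟨c, hc⟩ := hc (f.aroots Kbar) fun r hr => deg_lt_of_mem_aroots hf hr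
  refine ⟨f.eval c, ?_⟩
  have h1 : algebraMap K Kbar (f.eval c) = aeval (algebraMap K Kbar c) f := by
    rw [aeval_algebraMap_apply, coe_aeval_eq_eval]
  rw [h1, aeval_eq_mul_prod, aeval_eq_mul_prod, map_mul, map_mul, map_multiset_prod,
    map_multiset_prod, Multiset.map_map, Multiset.map_map]
  congr 2
  refine Multiset.map_congr rfl fun r hr => ?_
  -- Since `a - c` is strictly smaller than `a - r`, the ultrametric inequality gives `c - r` the
  -- value of `a - r`.
  have := v.map_sub_eq_of_lt_left (hc r hr)
  rw [sub_sub_sub_cancel_left] at this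
  rw [Function.comp_apply, Function.comp_apply, ← this, v.map_sub_swap]

/-! ### Description and separation of the ramification ideals -/

/-- Ramification ideals of a Galois extension generated by `g`, where all `w(σ z / z - 1)` are
controlled by `w(σ g - g)`. -/
theorem ramificationIdeals_eq_image {K L Γ₀ : Type*} [Field K] [Field L] [Algebra K L]
    [FiniteDimensional K L] [LinearOrderedCommGroupWithZero Γ₀] (w : Valuation L Γ₀) (g : L)
    {γ : Γ₀} (hinv : ∀ (σ : L ≃ₐ[K] L) x, w (σ x) = w x)
    (hfix : ∀ σ : L ≃ₐ[K] L, σ g = g → σ = 1)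
    (hle : ∀ σ : L ≃ₐ[K] L, w (σ g - g) ≤ γ)
    (hlt : ∀ σ : L ≃ₐ[K] L, σ ≠ 1 → ∀ z : L, z ≠ 0 → w (σ z / z - 1) * γ < w (σ g - g))
    (hdist : ∀ x : L, γ < w x → ∃ c : K, w (g - algebraMap K L c) = w x) :
    ramificationIdeals K w =
      (fun s => ltIdeal w γ s) '' {s | ∃ σ : L ≃ₐ[K] L, σ ≠ 1 ∧ s = w (σ g - g)} := by
  have hpos : ∀ σ : L ≃ₐ[K] L, σ ≠ 1 → 0 < w (σ g - g) := by
    intro σ hσ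
    rw [zero_lt_iff, w.ne_zero_iff, sub_ne_zero]
    exact fun h => hσ (hfix σ h)
  have hideal : ∀ (H : Subgroup (L ≃ₐ[K] L)) (σ : L ≃ₐ[K] L), σ ∈ H → σ ≠ 1 →
      (∀ τ ∈ H, w (τ g - g) ≤ w (σ g - g)) →
      idealOfSubgroup w H = ltIdeal w γ (w (σ g - g)) := by
    intro H σ hσH hσ hmax
    apply le_antisymm
    · rw [idealOfSubgroup, Ideal.span_le]
      rintro x ⟨τ, hτ, z, hz, hx⟩
      rw [SetLike.mem_coe, mem_ltIdeal, hx]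
      intro hx0
      have hτ1 : τ ≠ 1 := by
        rintro rfl
        apply hx0
        apply Subtype.ext
        rw [hx, AlgEquiv.one_apply, div_self hz, sub_self]
        rfl
      exact (hlt τ hτ1 z hz).trans_le (hmax τ hτ)
    · intro x hx
      rcases eq_or_ne x 0 with rfl | hx0
      · exact zero_mem _
      have hxL : (x : L) ≠ 0 := fun h => hx0 (Subtype.ext h)
      have hwx : 0 < w x := by rwa [zero_lt_iff, w.ne_zero_iff]
      have hx' := hx hx0
      -- Choosing `w (g - c) = w (σ g - g) / w x`, the generator of `I_H` coming from `z = g - c` is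
      -- `(σ g - g) / (g - c)`, of exactly the value of `x`.
      obtain ⟨c, hc⟩ := hdist ((σ g - g) / x) (by
        rwa [map_div₀, lt_div_iff₀ hwx, mul_comm])
      have hgc : g - algebraMap K L c ≠ 0 := by
        rw [← w.ne_zero_iff, hc, map_div₀]
        exact div_ne_zero (hpos σ hσ).ne' hwx.ne'
      set y := σ (g - algebraMap K L c) / (g - algebraMap K L c) - 1 with hy
      have hy' : y = (σ g - g) / (g - algebraMap K L c) := by
        rw [hy, map_sub, AlgEquiv.commutes]
        field_simp
        ring
      have hwy : w y = w x := by
        rw [hy', map_div₀, hc, map_div₀, div_div_cancel₀ (hpos σ hσ).ne']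
      have hy0 : y ≠ 0 := by rw [← w.ne_zero_iff, hwy]; exact hwx.ne'
      have hymem : (⟨y, hwy.trans_le x.2⟩ : w.valuationSubring) ∈ idealOfSubgroup w H :=
        Ideal.subset_span ⟨σ, hσH, _, hgc, hy⟩
      have hq : w ((x : L) / y) ≤ 1 := by rw [map_div₀, hwy, div_self hwx.ne']
      have : x = (⟨(x : L) / y, hq⟩ : w.valuationSubring) * ⟨y, hwy.trans_le x.2⟩ := by
        apply Subtype.ext
        exact (div_mul_cancel₀ _ hy0).symm
      rw [this]
      exact Ideal.mul_mem_left _ _ hymem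
  ext I
  constructor
  · rintro ⟨hbot, -, H, rfl⟩
    have hH : ∃ σ ∈ H, σ ≠ 1 := by
      by_contra! hH
      apply hbot
      rw [idealOfSubgroup, Ideal.span_eq_bot]
      rintro x ⟨τ, hτ, z, hz, hx⟩
      apply Subtype.ext
      rw [hx, hH τ hτ, AlgEquiv.one_apply, div_self hz, sub_self]
      rfl
    obtain ⟨σ₀, hσ₀, hσ₀1⟩ := hH
    obtain ⟨σ, hσ, hmax⟩ := Set.exists_max_image (H : Set (L ≃ₐ[K] L))
      (fun σ => w (σ g - g)) (Set.toFinite _) ⟨σ₀, hσ₀⟩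
    have hσ1 : σ ≠ 1 := by
      rintro rfl
      have := hmax σ₀ hσ₀
      rw [AlgEquiv.one_apply, sub_self, map_zero] at this
      exact (hpos σ₀ hσ₀1).not_ge this
    exact ⟨_, ⟨σ, hσ1, rfl⟩, (hideal H σ hσ hσ1 hmax).symm⟩
  · rintro ⟨_, ⟨σ, hσ, rfl⟩, rfl⟩
    dsimp only
    -- The automorphisms moving `g` no more than `σ` does form a subgroup, by the ultrametric
    -- inequality and invariance of `w`; its largest displacement is that of `σ`.
    let H : Subgroup (L ≃ₐ[K] L) :=
      { carrier := {τ | w (τ g - g) ≤ w (σ g - g)}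
        one_mem' := by simp
        mul_mem' := by
          intro τ ρ hτ hρ
          have h1 : (τ * ρ) g - g = τ (ρ g - g) + (τ g - g) := by
            rw [AlgEquiv.mul_apply, map_sub, sub_add_sub_cancel]
          rw [Set.mem_ofPred_eq, h1]
          refine (w.map_add _ _).trans (max_le ?_ hτ)
          rw [hinv]
          exact hρ
        inv_mem' := by
          intro τ hτ
          have h1 : τ⁻¹ g - g = - τ⁻¹ (τ g - g) := by
            rw [map_sub, neg_sub, ← AlgEquiv.mul_apply, inv_mul_cancel, AlgEquiv.one_apply]
          rw [Set.mem_ofPred_eq, h1, w.map_neg, hinv]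
          exact hτ }
    refine ⟨?_, ?_, H, (hideal H σ le_rfl hσ fun τ hτ => hτ).symm⟩
    · have hg : g ≠ 0 := by
        rintro rfl
        exact hσ (hfix σ (map_zero σ))
      have hy := hlt σ hσ g hg
      have hy1 : w (σ g / g - 1) < 1 := by
        have := hy.trans_le (hle σ)
        by_contra! h
        exact this.not_ge (by simpa using mul_le_mul_left h γ)
      rw [Submodule.ne_bot_iff]
      refine ⟨⟨σ g / g - 1, hy1.le⟩, fun _ => hy, fun h => ?_⟩
      have h0 : σ g / g - 1 = 0 := congrArg Subtype.val h
      rw [sub_eq_zero, div_eq_one_iff_eq hg] at h0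
      exact hσ (hfix σ h0)
    · intro x hx
      rw [mem_ltIdeal_of_pos (hpos σ hσ)] at hx
      rw [Valuation.mem_maximalIdeal_iff]
      have := hx.trans_le (hle σ)
      by_contra! h
      exact this.not_ge (by simpa using mul_le_mul_left h γ)

/-- Principality enters here, as the bound is a value `w e`: if `w y < w y'`, then `y / e` lies in
the ideal for `w y'` but not in the one for `w y`. -/
theorem ltIdeal_injOn {L Γ₀ : Type*} [Field L] [LinearOrderedCommGroupWithZero Γ₀]
    (w : Valuation L Γ₀) {e : L} (he : e ≠ 0) :
    Set.InjOn (fun s => ltIdeal w (w e) s) {s | s ≤ w e ∧ ∃ y : L, y ≠ 0 ∧ s = w y} := by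
  have he' : 0 < w e := by rwa [zero_lt_iff, w.ne_zero_iff]
  have key : ∀ y y' : L, y ≠ 0 → y' ≠ 0 → w y ≤ w e →
      ltIdeal w (w e) (w y) = ltIdeal w (w e) (w y') → ¬ w y < w y' := by
    intro y y' hy hy' hle heq hlt
    have hwx : w (y / e) * w e = w y := by rw [← map_mul, div_mul_cancel₀ _ he]
    have hx1 : w (y / e) ≤ 1 := by rw [map_div₀]; exact (div_le_one₀ he').2 hle
    have hmem : (⟨y / e, hx1⟩ : w.valuationSubring) ∈ ltIdeal w (w e) (w y') :=
      fun _ => hwx.trans_lt hlt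
    rw [← heq, mem_ltIdeal_of_pos (by rwa [zero_lt_iff, w.ne_zero_iff])] at hmem
    exact (hwx.symm.trans_lt hmem).false
  rintro _ ⟨hs, y, hy, rfl⟩ _ ⟨hs', y', hy', rfl⟩ heq
  exact le_antisymm (not_lt.1 (key y' y hy' hy hs' heq.symm)) (not_lt.1 (key y y' hy hy' hs heq))

end ValuedExtension

/-! ### Proof of the main theorem -/

open Polynomial in
open ValuedExtension in
open scoped IntermediateField in
theorem proposition8p18 {K Kbar Γ₀ : Type*} [Field K] [Field Kbar] [Algebra K Kbar]
    [IsAlgClosure K Kbar] [LinearOrderedCommGroupWithZero Γ₀]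
    (v : Valuation Kbar Γ₀)
    (hens : IsHenselian Kbar (restrict K v))
    (a : Kbar)
    (hgal : IsGalois K K⟮a⟯)
    (hdefect : 1 < defect K (restrict K⟮a⟯ v))
    (hpure : IsPure K v a)
    (hprincipal : IsPrincipalInitialSegment (valueGroup (restrict K v)) (distanceValues K v a)) :
    (ramificationIdeals K (restrict K⟮a⟯ v)).encard = (conjugateValues K v a).encard := by
  have : IsAlgClosed Kbar := IsAlgClosure.isAlgClosed K
  have : Algebra.IsAlgebraic K Kbar := IsAlgClosure.isAlgebraic
  have : Normal K Kbar := IsAlgClosure.normal K Kbar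
  have ha : IsIntegral K a := Algebra.IsIntegral.isIntegral a
  have : FiniteDimensional K K⟮a⟯ := IntermediateField.adjoin.finiteDimensional ha
  have hcl := hpure.exists_closer
  obtain ⟨γ, ⟨e, rfl⟩, hdist⟩ := hprincipal
  set γ : Γ₀ := v (algebraMap K Kbar e)
  have hγ : 0 < γ := by
    rw [zero_lt_iff, v.ne_zero_iff]
    simp
  have hlt : ∀ c : K, γ < v (a - algebraMap K Kbar c) ∧
      ∃ B : K, B ≠ 0 ∧ v (a - algebraMap K Kbar c) = v (algebraMap K Kbar B) := by
    intro c
    have hc : v (a - algebraMap K Kbar c) ∈ distanceValues K v a := ⟨c, rfl⟩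
    rw [hdist] at hc
    obtain ⟨_, ⟨B, rfl⟩, hlt, hB⟩ := hc
    refine ⟨?_, B, B.ne_zero, hB⟩
    rw [hB]
    exact Units.val_lt_val.2 hlt
  have hmem : ∀ B : K, γ < v (algebraMap K Kbar B) →
      ∃ c : K, v (a - algebraMap K Kbar c) = v (algebraMap K Kbar B) := by
    intro B hB
    have hB0 : B ≠ 0 := by
      rintro rfl
      simp at hB
    have : v (algebraMap K Kbar B) ∈ distanceValues K v a := by
      rw [hdist]
      exact ⟨_, ⟨Units.mk0 B hB0, rfl⟩, Units.val_lt_val.1 hB, rfl⟩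
    obtain ⟨c, hc⟩ := this
    exact ⟨c, hc.symm⟩
  have hno := exists_strictly_closer hdefect hcl fun c => (hlt c).2
  have hγlt : ∀ z : Kbar, deg K z < deg K a → γ < v (a - z) := by
    intro z hz
    obtain ⟨c, hc⟩ := hcl z hz
    exact (hlt c).1.trans_le hc
  have hrepr : ∀ x : K⟮a⟯, ∃ f : K[X], f.natDegree < deg K a ∧
      x = aeval (IntermediateField.AdjoinSimple.gen K a) f :=
    (IntermediateField.adjoin.powerBasis ha).exists_eq_aeval
  have hcoe : ∀ (y : K⟮a⟯) (f : K[X]), ((aeval y f : K⟮a⟯) : Kbar) = aeval (y : Kbar) f :=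
    fun y f => (aeval_algebraMap_apply Kbar y f).symm
  have himm : ∀ x : K⟮a⟯, ∃ k : K, v (algebraMap K Kbar k) = v (x : Kbar) := by
    intro x
    obtain ⟨f, hf, rfl⟩ := hrepr x
    rw [hcoe, IntermediateField.AdjoinSimple.coe_gen]
    exact exists_valuation_aeval_eq hcl hno hf
  set g := IntermediateField.AdjoinSimple.gen K a
  set w := restrict K⟮a⟯ v
  have hga : (g : Kbar) = a := IntermediateField.AdjoinSimple.coe_gen K a
  have hinv : ∀ (σ : K⟮a⟯ ≃ₐ[K] K⟮a⟯) x, w (σ x) = w x := by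
    intro σ x
    have h1 := hens.valuation_algEquiv (σ.liftNormal Kbar) (x : Kbar)
    have h2 := σ.liftNormal_commutes Kbar x
    rw [Valuation.comap_apply, ← h2, Valuation.comap_apply]
    exact h1
  have hfix : ∀ σ : K⟮a⟯ ≃ₐ[K] K⟮a⟯, σ g = g → σ = 1 := by
    intro σ h
    ext x
    obtain ⟨f, -, rfl⟩ := hrepr x
    rw [← aeval_algHom_apply σ, h, AlgEquiv.one_apply]
  have hle : ∀ σ : K⟮a⟯ ≃ₐ[K] K⟮a⟯, w (σ g - g) ≤ γ := by
    intro σ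
    -- A value above `γ` would equal some `v (a - c)`, and a closer `c'` exists. But `σ g - g` is
    -- the difference of `σ (g - c')` and `g - c'`, which have equal value.
    by_contra! h
    obtain ⟨k, hk⟩ := himm (σ g - g)
    obtain ⟨c, hc⟩ := hmem k (hk.symm ▸ h)
    obtain ⟨c', hc'⟩ := hno c
    rw [hc, hk] at hc'
    have h1 : σ g - g = σ (g - algebraMap K _ c') - (g - algebraMap K _ c') := by
      rw [map_sub, AlgEquiv.commutes, sub_sub_sub_cancel_right]
    have h2 : w (σ g - g) ≤ w (g - algebraMap K _ c') := by
      rw [h1]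
      exact (w.map_sub _ _).trans (max_le (hinv σ _).le le_rfl)
    exact h2.not_gt hc'
  have hunit : ∀ σ : K⟮a⟯ ≃ₐ[K] K⟮a⟯, σ ≠ 1 → ∀ z, z ≠ 0 →
      w (σ z / z - 1) * γ < w (σ g - g) := by
    intro σ hσ z hz
    obtain ⟨f, hf, rfl⟩ := hrepr z
    have hne : a ≠ (σ g : Kbar) := fun h => hσ (hfix σ (Subtype.ext h.symm))
    have hle' : v ((σ g : Kbar) - a) ≤ γ := hle σ
    have := valuation_prod_div_prod_sub_one v hγ hne hle' (f.aroots Kbar)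
      fun r hr => hγlt r (deg_lt_of_mem_aroots hf hr)
    have hlc : algebraMap K Kbar f.leadingCoeff ≠ 0 := by
      rw [Ne, map_eq_zero, leadingCoeff_eq_zero]
      rintro rfl
      simp at hz
    -- Restoring the leading coefficient turns the quotient of root products into `f (σ a) / f a`,
    -- that is, `σ z / z`.
    rw [← mul_div_mul_left _ _ hlc, ← aeval_eq_mul_prod, ← aeval_eq_mul_prod] at this
    rw [← aeval_algHom_apply σ]
    have hval : w (aeval (σ g) f / aeval g f - 1) = v (aeval (σ g : Kbar) f / aeval a f - 1) := by
      rw [Valuation.comap_apply]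
      refine congrArg v (congrArg (· - 1) (congrArg₂ (· / ·) (hcoe _ f) ?_))
      rw [hcoe, hga]
    exact hval ▸ this
  have hdist' : ∀ x : K⟮a⟯, γ < w x → ∃ c : K, w (g - algebraMap K _ c) = w x := by
    intro x hx
    obtain ⟨k, hk⟩ := himm x
    obtain ⟨c, hc⟩ := hmem k (hk.symm ▸ hx)
    exact ⟨c, hc.trans hk⟩
  -- Normality of `Kbar` and of `K⟮a⟯` over `K` lets automorphisms be lifted and restricted, so the
  -- conjugates of `a` are the `σ a`.
  have hconj : conjugateValues K v a =
      {s | ∃ σ : K⟮a⟯ ≃ₐ[K] K⟮a⟯, σ ≠ 1 ∧ s = w (σ g - g)} := by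
    ext s
    constructor
    · rintro ⟨a', ha', hne, rfl⟩
      obtain ⟨τ, rfl⟩ := isConjRoot_iff_exists_algEquiv.1 ha'.symm
      have h1 : ((τ.restrictNormal K⟮a⟯ g : K⟮a⟯) : Kbar) = τ a :=
        τ.restrictNormal_commutes K⟮a⟯ g
      refine ⟨τ.restrictNormal K⟮a⟯, fun h => hne ?_, ?_⟩
      · rw [← h1, h, AlgEquiv.one_apply, hga]
      · rw [v.map_sub_swap, ← h1]
        rfl
    · rintro ⟨σ, hσ, rfl⟩
      refine ⟨(σ g : Kbar), ?_, fun h => hσ (hfix σ (Subtype.ext h)), v.map_sub_swap _ _⟩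
      refine (isConjRoot_iff_exists_algEquiv.2 ⟨σ.liftNormal Kbar, ?_⟩).symm
      exact σ.liftNormal_commutes Kbar g
  rw [hconj, ramificationIdeals_eq_image w g hinv hfix hle hunit hdist']
  refine Set.InjOn.encard_image
    ((ltIdeal_injOn w (e := algebraMap K K⟮a⟯ e) (by simp)).mono ?_)
  rintro _ ⟨σ, hσ, rfl⟩
  exact ⟨hle σ, _, sub_ne_zero.2 fun h => hσ (hfix σ h), rfl⟩
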